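/- Let $n \ge 0$ be an integer and let $l_\infty^n = (\mathbb{R}^n, \|\cdot\|_\infty)$, where $\|\cdot\|_\infty$ is the maximum norm; $B(x,r)$ denotes the closed ball of centre $x$ and radius $r \ge 0$. A subset $A$ of a metric space $(Y,d)$ is called externally hyperconvex in $Y$ if it is nonempty and for every family of closed balls $\{B(x_i,r_i)\}_{i\in I}$ with $x_i \in Y$, $d(x_i,A) \le r_i$ and $d(x_i,x_j) \le r_i + r_j$ for all $i,j \in I$, one has $A \cap \bigcap_{i\in I} B(x_i,r_i) \neq \emptyset$. A subset $A$ of a metric space $X$ is called weakly externally hyperconvex in $X$ if for every $x \in X$ the set $A$ is externally hyperconvex in $A \cup \{x\}$. Write $\mathcal{W}(l_\infty^n)$ for the collection of all weakly externally hyperconvex subsets of $l_\infty^n$. A collection $\mathcal{F}$ of subsets of a set is a Helly family of order $k$ if every finite subcollection $\mathcal{G} \subseteq \mathcal{F}$ such that any at most $k$ members of $\mathcal{G}$ have nonempty intersection satisfies $\bigcap_{A \in \mathcal{G}} A \neq \emptyset$ (the intersection of the empty collection being the whole space). Theorem. The collection $\mathcal{W}(l_\infty^n)$ is a Helly family of order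 $n+1$. Moreover, if $n \ge 1$, this order is optimal: if $\mathcal{W}(l_\infty^n)$ is a Helly family of order $k$, then $k \ge n+1$. -/

import Mathlib

universe u

/-- For `A ⊆ Y ⊆ X`, the set `A` is externally hyperconvex in the metric subspace `Y`: for every
family of closed balls `B(x i, r i)` with centres in `Y`, `d(x i, A) ≤ r i` and
`d(x i, x j) ≤ r i + r j`, the balls have a common point in `A`. As `A ⊆ Y`, it makes no difference
whether the balls are taken in `Y` or in `X`. The families are arbitrary; the family without
members forces `A` to be nonempty, so `Metric.infDist _ A` is the true distance to `A`. -/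
def ExternallyHyperconvexIn {X : Type u} [MetricSpace X] (A Y : Set X) : Prop :=
  ∀ (ι : Type u) (x : ι → X) (r : ι → ℝ),
    (∀ i, x i ∈ Y) →
    (∀ i, Metric.infDist (x i) A ≤ r i) →
    (∀ i j, dist (x i) (x j) ≤ r i + r j) →
    ((⋂ i, Metric.closedBall (x i) (r i)) ∩ A).Nonempty

/-- `A` is weakly externally hyperconvex in `X`: for every point `x` of `X`, the set `A` is
externally hyperconvex in `A ∪ {x}`. -/
def WeaklyExternallyHyperconvex {X : Type u} [MetricSpace X] (A : Set X) : Prop :=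
  ∀ x : X, ExternallyHyperconvexIn A (A ∪ {x})

/-- `F` is a Helly family of order `k`: every finite subfamily `G` of `F`, all of whose subfamilies
with at most `k` members have nonempty intersection, has nonempty total intersection. -/
def IsHellyFamily {V : Type u} (F : Set (Set V)) (k : ℕ) : Prop :=
  ∀ G : Finset (Set V), (∀ A ∈ G, A ∈ F) →
    (∀ H : Finset (Set V), H ⊆ G → H.card ≤ k → (⋂ A ∈ H, A).Nonempty) →
    (⋂ A ∈ G, A).Nonempty

/-! ### Convexity of weakly externally hyperconvex sets. -/

section Convexity

variable {n : ℕ} {A : Set (Fin n → ℝ)}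

/-! Weakly externally hyperconvex subsets of `Fin n → ℝ` are convex (`add_smul_sub_mem`), so the
bound is the classical Helly theorem. For convexity, split `q - p = L • u + w`, with `L = ‖q - p‖`
and `u` the signs of the coordinates of maximal modulus. Among points `p + t • w + s • u`,
membership in `A` propagates along `u`, which reduces the segment from `p` to `q` to one with more
maximal coordinates.

The bound is sharp because of the cyclic chain `1 ≤ y 0 ≤ … ≤ y (n - 1) ≤ 0`: its `n + 1`
inequalities are inconsistent, but any `n` of them are solvable. -/

theorem WeaklyExternallyHyperconvex.mem_of_infDist_eq_zero {X : Type u} [MetricSpace X]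
    {A : Set X} (hA : WeaklyExternallyHyperconvex A) {x : X}
    (hx : Metric.infDist x A = 0) : x ∈ A := by
  obtain ⟨y, hy, hyA⟩ := hA x PUnit (fun _ => x) (fun _ => 0) (fun _ => by simp)
    (fun _ => hx.le) (fun _ _ => by simp)
  have h : dist y x ≤ 0 := by simpa using hy
  rwa [← dist_le_zero.1 h]

/-- A weakly externally hyperconvex set meets a ball around an arbitrary point and two balls around
points of the set as soon as these conditions on the radii hold. -/
theorem WeaklyExternallyHyperconvex.exists_mem_three_balls {X : Type u} [MetricSpace X]
    {A : Set X} (hA : WeaklyExternallyHyperconvex A) {z p q : X} (hp : p ∈ A) (hq : q ∈ A)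
    {a b c : ℝ} (ha : Metric.infDist z A ≤ a) (hb : 0 ≤ b) (hc : 0 ≤ c)
    (hzp : dist z p ≤ a + b) (hzq : dist z q ≤ a + c) (hpq : dist p q ≤ b + c) :
    ∃ g ∈ A, dist g z ≤ a ∧ dist g p ≤ b ∧ dist g q ≤ c := by
  have ha0 : 0 ≤ a := Metric.infDist_nonneg.trans ha
  obtain ⟨g, hg, hgA⟩ := hA z (ULift (Fin 3)) (fun i => ![z, p, q] i.down)
    (fun i => ![a, b, c] i.down)
    (by rintro ⟨i⟩; fin_cases i <;> simp [hp, hq])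
    (by rintro ⟨i⟩; fin_cases i <;> simp [ha, hb, hc, Metric.infDist_zero_of_mem, hp, hq])
    (by
      rintro ⟨i⟩ ⟨j⟩
      have h1 := dist_comm p z
      have h2 := dist_comm q z
      have h3 := dist_comm q p
      fin_cases i <;> fin_cases j <;> simp <;> linarith)
  rw [Set.mem_iInter] at hg
  exact ⟨g, hgA, by simpa using hg ⟨0⟩, by simpa using hg ⟨1⟩, by simpa using hg ⟨2⟩⟩

/-- If `p` and `q` lie in opposite directions from `z`, and the distances are realized exactly
by the coordinates in the support of the sign vector `u`, then the distance to `A` does not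
increase by moving from `z` along `u` by at most that distance. -/
theorem WeaklyExternallyHyperconvex.infDist_add_smul_le (hA : WeaklyExternallyHyperconvex A)
    {z p q u : Fin n → ℝ} (hp : p ∈ A) (hq : q ∈ A)
    (hu : ∀ i, u i = 0 ∨ (u i * u i = 1 ∧ u i * (z i - p i) = dist z p ∧
      u i * (q i - z i) = dist z q))
    {h : ℝ} (hh : |h| ≤ Metric.infDist z A) :
    Metric.infDist (z + h • u) A ≤ Metric.infDist z A := by
  obtain ⟨hh1, hh2⟩ := abs_le.1 hh
  have hzp := Metric.infDist_le_dist_of_mem (x := z) hp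
  have hzq := Metric.infDist_le_dist_of_mem (x := z) hq
  -- The balls around `p` and `q` squeeze `g` from both sides: on the support of `u` it agrees with
  -- `z + h • u`. Elsewhere the ball around `z` gives the bound.
  obtain ⟨g, hgA, hgz, hgp, hgq⟩ := hA.exists_mem_three_balls hp hq (z := z)
    (a := Metric.infDist z A) (b := dist z p + h) (c := dist z q - h) le_rfl
    (by linarith) (by linarith) (by linarith) (by linarith)
    (by linarith [dist_triangle_left p q z])
  refine (Metric.infDist_le_dist_of_mem hgA).trans ?_
  refine (dist_pi_le_iff Metric.infDist_nonneg).2 fun i => ?_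
  have hz := (dist_le_pi_dist g z i).trans hgz
  have hp' := (dist_le_pi_dist g p i).trans hgp
  have hq' := (dist_le_pi_dist g q i).trans hgq
  simp only [Real.dist_eq, Pi.add_apply, Pi.smul_apply, smul_eq_mul] at hz hp' hq' ⊢
  rcases hu i with h0 | ⟨h1, h2, h3⟩
  · rw [h0, mul_zero, add_zero, abs_sub_comm]
    exact hz
  · have hpos : 0 ≤ Metric.infDist z A := Metric.infDist_nonneg
    rcases mul_self_eq_one_iff.1 h1 with h4 | h4 <;> rw [h4] at h2 h3 ⊢ <;>
      rw [abs_le] at hp' hq' <;> refine abs_le.2 ⟨?_, ?_⟩ <;> linarith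

/-- If `f b > 0`, let `m` be the least point of `[a, b]` with `f m ≥ f b`. For `s < m` close to `m`,
continuity gives `m - s < f s`, so the step from `s` to `m` yields `f m ≤ f s`, against minimality.
-/
theorem eq_zero_of_eq_zero_left {f : ℝ → ℝ} (hf : Continuous f) {a b : ℝ} (hab : a ≤ b)
    (hstep : ∀ s ∈ Set.Icc a b, ∀ h, |h| ≤ f s → f (s + h) ≤ f s) (ha : f a = 0) : f b ≤ 0 := by
  by_contra! hb
  have hT : IsCompact {s ∈ Set.Icc a b | f b ≤ f s} :=
    isCompact_Icc.inter_right (isClosed_le continuous_const hf)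
  obtain ⟨m, ⟨⟨ham, hmb⟩, hm⟩, hmin⟩ := hT.exists_isLeast ⟨b, ⟨hab, le_rfl⟩, le_rfl⟩
  have ham' : a < m := lt_of_le_of_ne ham (by rintro rfl; linarith)
  have hcont : ∀ᶠ s in nhdsWithin m (Set.Iio m), m - s < f s ∧ a < s ∧ s < m := by
    have h1 : ∀ᶠ s in nhds m, m - s < f s ∧ a < s := by
      have h2 : Filter.Tendsto (fun s => m - s) (nhds m) (nhds 0) :=
        (by fun_prop : Continuous fun s => m - s).tendsto' _ _ (sub_self m)
      exact (h2.eventually_lt hf.continuousAt (hb.trans_le hm)).and (lt_mem_nhds ham')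
    filter_upwards [nhdsWithin_le_nhds h1, self_mem_nhdsWithin] with s hs hs'
    exact ⟨hs.1, hs.2, hs'⟩
  obtain ⟨s, hs1, hs2, hs3⟩ := hcont.exists
  have key := hstep s ⟨hs2.le, hs3.le.trans hmb⟩ (m - s) (by rw [abs_of_pos] <;> linarith)
  rw [add_sub_cancel] at key
  exact absurd (hmin ⟨⟨hs2.le, hs3.le.trans hmb⟩, hm.trans key⟩) (not_le.2 hs3)

theorem eq_zero_of_eq_zero_right {f : ℝ → ℝ} (hf : Continuous f) {a b : ℝ} (hab : a ≤ b)
    (hstep : ∀ s ∈ Set.Icc a b, ∀ h, |h| ≤ f s → f (s + h) ≤ f s) (hb : f b = 0) : f a ≤ 0 := by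
  have := eq_zero_of_eq_zero_left (f := fun s => f (-s)) (by fun_prop) (neg_le_neg hab)
    (fun s hs h hh => by
      have := hstep (-s) ⟨by linarith [hs.2], by linarith [hs.1]⟩ (-h) (by rwa [abs_neg])
      rwa [← neg_add] at this) (by simpa using hb)
  simpa using this

/-- Induction on the number of coordinates in which `q - p` falls short of its norm. -/
theorem WeaklyExternallyHyperconvex.add_smul_sub_mem (hA : WeaklyExternallyHyperconvex A) :
    ∀ (k : ℕ) (p q : Fin n → ℝ), p ∈ A → q ∈ A →
      (Finset.univ.filter fun i => |q i - p i| < ‖q - p‖).card ≤ k →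
      ∀ θ ∈ Set.Icc (0 : ℝ) 1, p + θ • (q - p) ∈ A := by
  intro k
  induction k using Nat.strong_induction_on with
  | _ k ih =>
  intro p q hp hq hk θ hθ
  rcases eq_or_ne p q with rfl | hne
  · simpa using hp
  obtain ⟨L, hL⟩ : ∃ L, L = ‖q - p‖ := ⟨_, rfl⟩
  have hLpos : 0 < L := hL ▸ norm_pos_iff.2 (sub_ne_zero.2 hne.symm)
  have hle : ∀ i, |q i - p i| ≤ L := fun i => hL ▸ norm_le_pi_norm (q - p) i
  obtain ⟨u, hu⟩ : ∃ u : Fin n → ℝ, ∀ i, u i = if |q i - p i| < L then 0 else (q i - p i) / L :=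
    ⟨_, fun _ => rfl⟩
  obtain ⟨w, hw⟩ : ∃ w : Fin n → ℝ, w = q - p - L • u := ⟨_, rfl⟩
  have hwi : ∀ i, w i = q i - p i - L * u i := fun i => by simp [hw]
  have hlt : ∀ i, |q i - p i| < L → u i = 0 := fun i hi => by rw [hu, if_pos hi]
  have hmax : ∀ i, ¬ |q i - p i| < L → u i * u i = 1 ∧ w i = 0 := fun i hi => by
    have h1 : |q i - p i| = L := le_antisymm (hle i) (not_lt.1 hi)
    have h2 : (q i - p i) * (q i - p i) = L * L := by rw [← h1, abs_mul_abs_self]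
    have h3 : u i = (q i - p i) / L := by rw [hu, if_neg hi]
    refine ⟨?_, ?_⟩
    · rw [h3, div_mul_div_comm, h2, div_self (by positivity)]
    · rw [hwi, h3]; field_simp; ring
  have hu1 : ∀ i, |u i| ≤ 1 := fun i => by
    by_cases hi : |q i - p i| < L
    · simp [hlt i hi]
    · exact (abs_le_one_iff_mul_self_le_one).2 (hmax i hi).1.le
  have : Nonempty (Fin n) := by
    by_contra hemp
    rw [not_nonempty_iff] at hemp
    exact hne (Subsingleton.elim _ _)
  obtain ⟨M, hM⟩ : ∃ M, M = ‖w‖ := ⟨_, rfl⟩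
  have hM0 : 0 ≤ M := hM ▸ norm_nonneg w
  have hwM : ∀ i, |w i| ≤ M := fun i => hM ▸ norm_le_pi_norm w i
  have hML : M < L := by
    rw [hM, pi_norm_lt_iff hLpos]
    intro i
    by_cases hi : |q i - p i| < L
    · rw [hwi, hlt i hi, mul_zero, sub_zero]; exact hi
    · rw [(hmax i hi).2, norm_zero]; exact hLpos
  obtain ⟨i₀, hi₀⟩ : ∃ i, ¬ |q i - p i| < L := by
    by_contra! hall
    exact lt_irrefl L (by nth_rewrite 1 [hL]; exact (pi_norm_lt_iff hLpos).2 hall)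
  have hq' : q = p + (L • u + w) := by rw [hw]; abel
  -- The range `t * M ≤ s ≤ t * L` makes the coordinates in the support of `u` dominate, so the
  -- distances to `p` and `q` are exactly `s` and `L - s`.
  have hline : ∀ t ∈ Set.Icc (0 : ℝ) 1, ∀ s ∈ Set.Icc (t * M) (t * L), ∀ h,
      |h| ≤ Metric.infDist (p + t • w + s • u) A →
      Metric.infDist (p + t • w + (s + h) • u) A ≤ Metric.infDist (p + t • w + s • u) A := by
    rintro t ⟨ht0, ht1⟩ s ⟨hs1, hs2⟩ h hh
    have hs0 : 0 ≤ s := (mul_nonneg ht0 hM0).trans hs1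
    have hs3 : (1 - t) * M ≤ L - s := by nlinarith
    have hLs : 0 ≤ L - s := (mul_nonneg (by linarith) hM0).trans hs3
    have hnorm : ∀ c d : ℝ, 0 ≤ d → d * M ≤ c → ‖c • u + d • w‖ = c := by
      intro c d hd hdc
      have hc : 0 ≤ c := (mul_nonneg hd hM0).trans hdc
      apply le_antisymm
      · refine (pi_norm_le_iff_of_nonneg hc).2 fun i => ?_
        simp only [Pi.add_apply, Pi.smul_apply, smul_eq_mul, Real.norm_eq_abs]
        by_cases hi : |q i - p i| < L
        · rw [hlt i hi, mul_zero, zero_add, abs_mul, abs_of_nonneg hd]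
          exact (mul_le_mul_of_nonneg_left (hwM i) hd).trans hdc
        · rw [(hmax i hi).2, mul_zero, add_zero, abs_mul, abs_of_nonneg hc]
          exact mul_le_of_le_one_right hc (hu1 i)
      · refine le_trans ?_ (norm_le_pi_norm (c • u + d • w) i₀)
        simp only [Pi.add_apply, Pi.smul_apply, smul_eq_mul, Real.norm_eq_abs]
        rw [(hmax i₀ hi₀).2, mul_zero, add_zero, abs_mul, abs_of_nonneg hc]
        rcases mul_self_eq_one_iff.1 (hmax i₀ hi₀).1 with h4 | h4 <;> simp [h4]
    have hdp : dist (p + t • w + s • u) p = s := by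
      refine Eq.trans ?_ (hnorm s t ht0 hs1)
      rw [dist_eq_norm]; congr 1; abel
    have hdq : dist (p + t • w + s • u) q = L - s := by
      refine Eq.trans ?_ (hnorm (L - s) (1 - t) (by linarith) hs3)
      rw [dist_comm, dist_eq_norm, hq']
      congr 1; module
    have := hA.infDist_add_smul_le hp hq (z := p + t • w + s • u) (u := u) (fun i => by
      by_cases hi : |q i - p i| < L
      · exact Or.inl (hlt i hi)
      · obtain ⟨h1, h2⟩ := hmax i hi
        refine Or.inr ⟨h1, ?_, ?_⟩
        · rw [hdp]; simp only [Pi.add_apply, Pi.smul_apply, smul_eq_mul, h2]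
          linear_combination s * h1
        · rw [hdq, hq']; simp only [Pi.add_apply, Pi.smul_apply, smul_eq_mul, h2]
          linear_combination (L - s) * h1) hh
    rwa [add_assoc, ← add_smul] at this
  have hcont : ∀ t : ℝ, Continuous fun s : ℝ => Metric.infDist (p + t • w + s • u) A := fun t =>
    (Metric.continuous_infDist_pt A).comp (by fun_prop)
  -- Slide from `q` back along `u` until `s = M`, where the largest coordinates of `w` become
  -- maximal too.
  have hq1 : p + (M • u + w) ∈ A := by
    have h0 := eq_zero_of_eq_zero_right (hcont 1) (a := 1 * M) (b := 1 * L) (by linarith)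
      (hline 1 (by simp)) (by
        rw [Metric.infDist_zero_of_mem]
        convert hq using 1
        rw [hq']; module)
    have h1 := hA.mem_of_infDist_eq_zero (le_antisymm h0 Metric.infDist_nonneg)
    convert h1 using 1
    module
  have hseg : p + θ • (M • u + w) ∈ A := by
    rcases hM0.eq_or_lt with hM' | hMpos
    · have : w = 0 := norm_eq_zero.1 (by rw [← hM, ← hM'])
      simpa [this, ← hM'] using hp
    have hv : ∀ i, |M * u i + w i| ≤ M ∧ (¬ |q i - p i| < L → |M * u i + w i| = M) := fun i => by
      by_cases hi : |q i - p i| < L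
      · exact ⟨by rw [hlt i hi, mul_zero, zero_add]; exact hwM i, fun h => absurd hi h⟩
      · have : |M * u i + w i| = M := by
          rw [(hmax i hi).2, add_zero, abs_mul, abs_of_nonneg hM0]
          rcases mul_self_eq_one_iff.1 (hmax i hi).1 with h4 | h4 <;> simp [h4]
        exact ⟨this.le, fun _ => this⟩
    have hnorm : ‖M • u + w‖ = M := by
      refine le_antisymm ((pi_norm_le_iff_of_nonneg hM0).2 fun i => (hv i).1) ?_
      exact ((hv i₀).2 hi₀).ge.trans (norm_le_pi_norm (M • u + w) i₀)
    -- The coordinate `j` is newly maximal, so the count drops strictly.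
    obtain ⟨j, hj⟩ : ∃ j, |w j| = M := by
      by_contra! hall
      refine lt_irrefl M ?_
      nth_rewrite 1 [hM]
      exact (pi_norm_lt_iff hMpos).2 fun i => lt_of_le_of_ne (hwM i) (hall i)
    have hjL : |q j - p j| < L := by
      by_contra hj'
      rw [(hmax j hj').2, abs_zero] at hj
      exact hMpos.ne hj
    have hcard : (Finset.univ.filter fun i =>
        |(p + (M • u + w)) i - p i| < ‖p + (M • u + w) - p‖).card < k := by
      refine lt_of_lt_of_le (Finset.card_lt_card ?_) hk
      rw [Finset.ssubset_iff_of_subset]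
      · refine ⟨j, by simpa [← hL] using hjL, ?_⟩
        simp [hlt j hjL, hj, hnorm]
      · intro i
        simp only [Finset.mem_filter, Finset.mem_univ, true_and, add_sub_cancel_left, hnorm,
          Pi.add_apply, Pi.smul_apply, smul_eq_mul, ← hL]
        intro hi
        by_contra hi'
        exact hi.ne ((hv i).2 hi')
    simpa using ih _ hcard p _ hp hq1 le_rfl θ hθ
  -- Slide forward from `p + θ • (M • u + w)` to `p + θ • (L • u + w)`.
  have h0 := eq_zero_of_eq_zero_left (hcont θ) (a := θ * M) (b := θ * L)
    (mul_le_mul_of_nonneg_left hML.le hθ.1) (hline θ hθ) (by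
      rw [Metric.infDist_zero_of_mem]
      convert hseg using 1
      module)
  have h1 := hA.mem_of_infDist_eq_zero (le_antisymm h0 Metric.infDist_nonneg)
  convert h1 using 1
  rw [hq']
  module

theorem WeaklyExternallyHyperconvex.convex (hA : WeaklyExternallyHyperconvex A) :
    Convex ℝ A := by
  intro p hp q hq a b ha hb hab
  have := hA.add_smul_sub_mem _ p q hp hq le_rfl b ⟨hb, by linarith⟩
  convert this using 1
  rw [eq_sub_of_add_eq hab]
  module

theorem isHellyFamily_weaklyExternallyHyperconvex (n : ℕ) :
    IsHellyFamily {A : Set (Fin n → ℝ) | WeaklyExternallyHyperconvex A} (n + 1) := by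
  intro G hG hH
  refine Convex.helly_theorem' (𝕜 := ℝ) (F := fun A : Set (Fin n → ℝ) => A)
    (fun A hA => (hG A hA).convex) fun H hHG hcard => hH H hHG (by simpa using hcard)

end Convexity

/-! ### Sharpness of the order `n + 1`. -/

section Optimality

variable {n : ℕ}

/-- Pairwise intersecting balls of the maximum norm have a box as common intersection. -/
theorem exists_box_of_dist_le {ι : Type*} [Nonempty ι] {x : ι → Fin n → ℝ} {r : ι → ℝ}
    (h : ∀ i j, dist (x i) (x j) ≤ r i + r j) :
    ∃ L U : Fin n → ℝ, (∀ k, IsLUB (Set.range fun i => x i k - r i) (L k)) ∧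
      (∀ k, IsGLB (Set.range fun i => x i k + r i) (U k)) ∧ (∀ k, L k ≤ U k) ∧
      ∀ y, (∀ k, L k ≤ y k ∧ y k ≤ U k) → ∀ i, y ∈ Metric.closedBall (x i) (r i) := by
  have key : ∀ i j k, x i k - r i ≤ x j k + r j := fun i j k => by
    have := (dist_le_pi_dist (x i) (x j) k).trans (h i j)
    rw [Real.dist_eq, abs_le] at this
    linarith
  have hL : ∀ k, IsLUB (Set.range fun i => x i k - r i) (⨆ i, (x i k - r i)) := fun k =>
    isLUB_ciSup ⟨x (Classical.arbitrary ι) k + r (Classical.arbitrary ι), by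
      rintro _ ⟨i, rfl⟩; exact key _ _ _⟩
  have hU : ∀ k, IsGLB (Set.range fun i => x i k + r i) (⨅ i, (x i k + r i)) := fun k =>
    isGLB_ciInf ⟨x (Classical.arbitrary ι) k - r (Classical.arbitrary ι), by
      rintro _ ⟨i, rfl⟩; exact key _ _ _⟩
  refine ⟨_, _, hL, hU, fun k => ciSup_le fun i => le_ciInf fun j => key i j k, fun y hy i => ?_⟩
  have hr : 0 ≤ r i := by have := h i i; rw [dist_self] at this; linarith
  refine (dist_pi_le_iff hr).2 fun k => ?_
  have h1 := (hL k).1 ⟨i, rfl⟩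
  have h2 := (hU k).1 ⟨i, rfl⟩
  have h3 := hy k
  simp only at h1 h2
  rw [Real.dist_eq, abs_le]
  constructor <;> linarith

theorem weaklyExternallyHyperconvex_setOf_apply_le (j : Fin n) (c : ℝ) :
    WeaklyExternallyHyperconvex {y : Fin n → ℝ | y j ≤ c} := by
  intro z ι x r _ hd hr
  have hne : {y : Fin n → ℝ | y j ≤ c}.Nonempty := ⟨fun _ => c, le_refl c⟩
  rcases isEmpty_or_nonempty ι with hι | hι
  · simpa using hne
  obtain ⟨L, U, hL, -, hLU, hb⟩ := exists_box_of_dist_le hr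
  -- The corner of the box with the least `j`-th coordinate is the best candidate.
  refine ⟨L, Set.mem_iInter.2 (hb L fun k => ⟨le_rfl, hLU k⟩), (hL j).2 ?_⟩
  rintro _ ⟨i, rfl⟩
  have : x i j - c ≤ Metric.infDist (x i) {y : Fin n → ℝ | y j ≤ c} := by
    refine (Metric.le_infDist hne).2 fun {y} hy => ?_
    have h1 := (le_abs_self _).trans (dist_le_pi_dist (x i) y j)
    have h2 : y j ≤ c := hy
    linarith
  have := hd i
  simp only
  linarith

theorem weaklyExternallyHyperconvex_setOf_le_apply (j : Fin n) (c : ℝ) :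
    WeaklyExternallyHyperconvex {y : Fin n → ℝ | c ≤ y j} := by
  intro z ι x r _ hd hr
  have hne : {y : Fin n → ℝ | c ≤ y j}.Nonempty := ⟨fun _ => c, le_refl c⟩
  rcases isEmpty_or_nonempty ι with hι | hι
  · simpa using hne
  obtain ⟨L, U, -, hU, hLU, hb⟩ := exists_box_of_dist_le hr
  refine ⟨U, Set.mem_iInter.2 (hb U fun k => ⟨hLU k, le_rfl⟩), (hU j).2 ?_⟩
  rintro _ ⟨i, rfl⟩
  have : c - x i j ≤ Metric.infDist (x i) {y : Fin n → ℝ | c ≤ y j} := by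
    refine (Metric.le_infDist hne).2 fun {y} hy => ?_
    have h1 := (neg_le_abs _).trans (dist_le_pi_dist (x i) y j)
    have h2 : c ≤ y j := hy
    linarith
  have := hd i
  simp only
  linarith

theorem weaklyExternallyHyperconvex_setOf_apply_le_apply {i j : Fin n} (hij : i ≠ j) :
    WeaklyExternallyHyperconvex {y : Fin n → ℝ | y i ≤ y j} := by
  intro z ι x r hx hd hr
  have hne : {y : Fin n → ℝ | y i ≤ y j}.Nonempty := ⟨0, le_refl (0 : ℝ)⟩
  rcases isEmpty_or_nonempty ι with hι | hι
  · simpa using hne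
  have hdist : ∀ a, x a i - x a j ≤ 2 * r a := fun a => by
    have : (x a i - x a j) / 2 ≤ Metric.infDist (x a) {y : Fin n → ℝ | y i ≤ y j} := by
      refine (Metric.le_infDist hne).2 fun {y} hy => ?_
      have h1 := (le_abs_self _).trans (dist_le_pi_dist (x a) y i)
      have h2 := (neg_le_abs _).trans (dist_le_pi_dist (x a) y j)
      have h3 : y i ≤ y j := hy
      linarith
    linarith [hd a]
  obtain ⟨L, U, hL, hU, hLU, hb⟩ := exists_box_of_dist_le hr
  have hkey : L i ≤ U j := by
    refine (hL i).2 ?_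
    rintro _ ⟨a, rfl⟩
    refine (hU j).2 ?_
    rintro _ ⟨b, rfl⟩
    have h1 := (le_abs_self _).trans ((dist_le_pi_dist (x a) (x b) i).trans (hr a b))
    have h2 := (le_abs_self _).trans ((dist_le_pi_dist (x a) (x b) j).trans (hr a b))
    simp only
    -- A centre in the set lets one pass from coordinate `i` to `j` at that centre. Otherwise both
    -- centres equal `z`, and averaging the two distance bounds suffices.
    rcases hx a with ha | ha
    · have : x a i ≤ x a j := ha
      linarith
    rcases hx b with hb' | hb'
    · have : x b i ≤ x b j := hb'
      linarith
    · have ha' : x a = z := ha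
      have hb'' : x b = z := hb'
      have h3 := hdist a
      have h4 := hdist b
      rw [ha'] at h3 ⊢
      rw [hb''] at h4 ⊢
      linarith
  refine ⟨Function.update L j (U j), Set.mem_iInter.2 (hb _ fun k => ?_), ?_⟩
  · rcases eq_or_ne k j with rfl | hk
    · simpa using hLU k
    · simpa [hk] using hLU k
  · simpa [hij] using hkey

/-- The sequence `1, y 0, …, y (n - 1), 0, 0, …`. -/
noncomputable def paddedSeq (y : Fin n → ℝ) : ℕ → ℝ
  | 0 => 1
  | k + 1 => if h : k < n then y ⟨k, h⟩ else 0

/-- For `n = 0` the only condition would be `1 ≤ 0`, and the empty set is not weakly externally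
hyperconvex. -/
theorem weaklyExternallyHyperconvex_setOf_paddedSeq_le (hn : 1 ≤ n) {i : ℕ} (hi : i ≤ n) :
    WeaklyExternallyHyperconvex {y : Fin n → ℝ | paddedSeq y i ≤ paddedSeq y (i + 1)} := by
  cases i with
  | zero => simpa [paddedSeq, Nat.lt_of_succ_le hn] using
      weaklyExternallyHyperconvex_setOf_le_apply ⟨0, hn⟩ 1
  | succ i =>
    have h1 : i < n := hi
    by_cases h2 : i + 1 < n
    · simpa [paddedSeq, h1, h2] using
        weaklyExternallyHyperconvex_setOf_apply_le_apply (i := ⟨i, h1⟩) (j := ⟨i + 1, h2⟩)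
          (by simp)
    · simpa [paddedSeq, h1, h2] using weaklyExternallyHyperconvex_setOf_apply_le ⟨i, h1⟩ 0

theorem exists_paddedSeq_le_of_ne (i : Fin (n + 1)) :
    ∃ y : Fin n → ℝ, ∀ k : Fin (n + 1), k ≠ i → paddedSeq y k ≤ paddedSeq y (k + 1) := by
  -- The padded sequence is then `1` up to index `i` and `0` afterwards, so its only descent is the
  -- omitted inequality.
  refine ⟨fun k => if (k : ℕ) < i then 1 else 0, fun k hk => ?_⟩
  have hval : ∀ m : ℕ, paddedSeq (fun k : Fin n => if (k : ℕ) < i then (1 : ℝ) else 0) m =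
      if m ≤ i then 1 else 0 := by
    intro m
    cases m with
    | zero => simp [paddedSeq]
    | succ m =>
      have := i.is_le
      by_cases hm : m < n
      · simp [paddedSeq, hm]
      · have : ¬ (m + 1 ≤ i) := by omega
        simp [paddedSeq, hm, this]
  have hk' : (k : ℕ) ≠ i := fun h => hk (Fin.ext h)
  rw [hval, hval]
  split_ifs <;> first | omega | norm_num

theorem le_of_isHellyFamily_of_minimal {V : Type u} {F : Set (Set V)} {k m : ℕ}
    (hF : IsHellyFamily F k) (C : Fin m → Set V) (hC : ∀ i, C i ∈ F)
    (hempty : ¬ (⋂ i, C i).Nonempty) (hne : ∀ i, (⋂ j ≠ i, C j).Nonempty) : m ≤ k := by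
  classical
  by_contra! hkm
  -- Distinctness ensures that a subfamily with fewer than `m` members omits some `C i`.
  have hinj : Function.Injective C := by
    intro i j hij
    by_contra hne'
    obtain ⟨y, hy⟩ := hne i
    simp only [Set.mem_iInter] at hy
    refine hempty ⟨y, Set.mem_iInter.2 fun l => ?_⟩
    rcases eq_or_ne l i with rfl | hl
    · rw [hij]; exact hy j fun h => hne' h.symm
    · exact hy l hl
  obtain ⟨y, hy⟩ := hF (Finset.univ.image C) (by simpa using hC) fun H hH hcard => by
    obtain ⟨i, hi⟩ : ∃ i, C i ∉ H := by
      by_contra! hall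
      have h1 : Finset.univ.image C ⊆ H := by
        intro B hB
        obtain ⟨i, -, rfl⟩ := Finset.mem_image.1 hB
        exact hall i
      have h2 := Finset.card_le_card h1
      rw [Finset.card_image_of_injective _ hinj, Finset.card_fin] at h2
      omega
    obtain ⟨y, hy⟩ := hne i
    simp only [Set.mem_iInter] at hy
    refine ⟨y, Set.mem_iInter₂.2 fun B hB => ?_⟩
    obtain ⟨l, -, rfl⟩ := Finset.mem_image.1 (hH hB)
    exact hy l (by rintro rfl; exact hi hB)
  refine hempty ⟨y, Set.mem_iInter.2 fun i => ?_⟩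
  exact Set.mem_iInter₂.1 hy (C i) (Finset.mem_image_of_mem _ (Finset.mem_univ i))

theorem le_of_isHellyFamily_weaklyExternallyHyperconvex (hn : 1 ≤ n) {k : ℕ}
    (hk : IsHellyFamily {A : Set (Fin n → ℝ) | WeaklyExternallyHyperconvex A} k) : n + 1 ≤ k := by
  refine le_of_isHellyFamily_of_minimal hk
    (fun i : Fin (n + 1) => {y | paddedSeq y i ≤ paddedSeq y (i + 1)})
    (fun i => weaklyExternallyHyperconvex_setOf_paddedSeq_le hn i.is_le) ?_ fun i => ?_
  · rintro ⟨y, hy⟩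
    rw [Set.mem_iInter] at hy
    have hmono : ∀ m ≤ n + 1, 1 ≤ paddedSeq y m := by
      intro m
      induction m with
      | zero => intro _; exact le_rfl
      | succ m ih =>
        intro hm
        exact (ih (by omega)).trans (hy ⟨m, hm⟩)
    have := hmono (n + 1) le_rfl
    simp [paddedSeq] at this
    linarith
  · obtain ⟨y, hy⟩ := exists_paddedSeq_le_of_ne i
    exact ⟨y, Set.mem_iInter₂.2 fun j hj => hy j hj⟩

end Optimality

/-- The space `Fin n → ℝ` carries the maximum norm. -/
theorem mainTheorem4 (n : ℕ) :
    IsHellyFamily {A : Set (Fin n → ℝ) | WeaklyExternallyHyperconvex A} (n + 1) ∧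
    (1 ≤ n → ∀ k : ℕ,
      IsHellyFamily {A : Set (Fin n → ℝ) | WeaklyExternallyHyperconvex A} k → n + 1 ≤ k) :=
  ⟨isHellyFamily_weaklyExternallyHyperconvex n,
    fun hn _ hk => le_of_isHellyFamily_weaklyExternallyHyperconvex hn hk⟩
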